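/- Work in ZFC. Let $S=\mathrm{Sym}(\omega)$ be the group of all permutations of the set of natural numbers. For a group $G$, the cofinality spectrum $CF(G)$ is the set of all regular (infinite) cardinals $\lambda$ such that $G$ is the union of a chain of $\lambda$ proper subgroups, that is, such that there are proper subgroups $\langle G_i \mid i<\lambda\rangle$ of $G$ with $G_i\subseteq G_j$ for all $i\le j<\lambda$ and $G=\bigcup_{i<\lambda}G_i$. Theorem 1.2. If $\aleph_n\in CF(S)$ for every natural number $n\ge 1$, then $\aleph_{\omega+1}\in CF(S)$. -/

import Mathlib

open scoped Cardinal Ordinal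

universe u

/-- The cofinality spectrum `CF(G)` of a group `G`: the set of all regular (in particular infinite)
cardinals `κ` such that `G` is the union of a chain `⟨H i | i < κ⟩` of proper subgroups. The chain
is indexed by the ordinals below the initial ordinal of `κ` and is increasing under inclusion.
As `κ` is regular and each `H i` is proper, such a chain can always be thinned out to a strictly
increasing one of the same length, so requiring strict inclusions gives the same set of
cardinals. -/
def cofinalitySpectrum (G : Type u) [Group G] : Set Cardinal.{u} :=
  {κ | κ.IsRegular ∧ ∃ H : Set.Iio κ.ord → Subgroup G,
    Monotone H ∧ (∀ i, H i ≠ ⊤) ∧ ∀ g : G, ∃ i, g ∈ H i}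

/-! The argument combines pcf theory with a diagonalization in Sym(ω).

On the pcf side there are an ultrafilter D on ω and ordinals g n, with cof (g n) in {ℵ_1, ℵ_2, …}
for D-almost all n, such that ∏ g n modulo D has an increasing cofinal sequence ⟨f ξ⟩ of length
ω_{ω+1}. This sequence is first built in ∏ ω_(n+5), each f ξ with cof ξ = ω_3 dominating, at every
coordinate, the f η with η in a club of ξ. Club guessing (`exists_club_guessing`) turns this into
the bounding projection property (`exists_forall_eventually_le_leastAbove`): for countable sets S n,
the rounding of f ξ up to S stabilizes modulo D. Hence a least upper bound g exists, and its
cofinalities are uncountable. As D is an ultrafilter, least means exact: every u below g is below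
some f ξ.

On the group side, the hypothesis gives a chain ⟨K n x | x < g n⟩ of proper subgroups for almost
every n. Let H ξ consist of the π that lie in K n (f ξ n) for D-almost all n. The H ξ increase with
f, and they exhaust Sym(ω) because f is cofinal. They are proper because some single σ avoids all
the K n (f ξ n): by Macpherson and Neumann (`exists_finite_forall_eq_top`) no member of a proper
chain induces the full symmetric group on a moiety, so σ can be chosen separately on each of
countably many disjoint moieties. -/

/-! ### Recursion and bounds in well-orders -/

/-- Well-founded recursion for a relation `P i δ b` that depends only on `δ` below `i`. -/
theorem exists_transfinite_sequence {ι β : Type*} [LT ι] [WellFoundedLT ι] [Nonempty β]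
    (P : ι → (ι → β) → β → Prop) (hP : ∀ i δ, ∃ b, P i δ b)
    (hcongr : ∀ i δ δ' b, (∀ j < i, δ j = δ' j) → P i δ b → P i δ' b) :
    ∃ δ : ι → β, ∀ i, P i δ (δ i) := by
  classical
  choose F hF using hP
  -- A junk value at indices not below `i`; `hcongr` makes it irrelevant.
  let d : β := Classical.arbitrary β
  let δ : ι → β := (wellFounded_lt (α := ι)).fix
    fun i prev ↦ F i fun j ↦ if h : j < i then prev j h else d
  refine ⟨δ, fun i ↦ ?_⟩
  have h : δ i = F i fun j ↦ if j < i then δ j else d := by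
    simp only [δ]
    rw [WellFounded.fix_eq]
    simp
  rw [h]
  exact hcongr i _ _ _ (fun j hj ↦ by simp [hj]) (hF i _)

theorem exists_forall_lt_of_mk_lt_cof {α : Type u} [LinearOrder α] {s : Set α}
    (h : #s < Order.cof α) : ∃ b, ∀ a ∈ s, a < b :=
  not_isCofinal_iff.1 fun hs ↦ (Order.cof_le hs).not_gt h

theorem exists_forall_apply_lt_of_mk_lt_cof {α ι : Type u} [LinearOrder α]
    (h : #ι < Order.cof α) (f : ι → α) : ∃ b, ∀ i, f i < b := by
  obtain ⟨b, hb⟩ := exists_forall_lt_of_mk_lt_cof (Cardinal.mk_range_le.trans_lt h) (s := Set.range f)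
  exact ⟨b, fun i ↦ hb _ ⟨i, rfl⟩⟩

theorem exists_isLUB_of_forall_le {α : Type*} [LinearOrder α] [WellFoundedLT α] {s : Set α} {b : α}
    (h : ∀ a ∈ s, a ≤ b) : ∃ x, IsLUB s x := by
  have hne : (upperBounds s).Nonempty := ⟨b, h⟩
  exact ⟨wellFounded_lt.min _ hne, wellFounded_lt.min_mem _ hne,
    fun y hy ↦ wellFounded_lt.min_le hy⟩

theorem exists_isLeast_of_nonempty {α : Type*} [LinearOrder α] [WellFoundedLT α] {s : Set α}
    (hne : s.Nonempty) : ∃ x, IsLeast s x :=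
  ⟨wellFounded_lt.min _ hne, wellFounded_lt.min_mem _ hne, fun _ hy ↦ wellFounded_lt.min_le hy⟩

theorem mk_Iio_lt_cof {o : Ordinal.{u}} (h : o.cof.ord = o) (i : o.ToType) :
    #(Set.Iio i) < Order.cof o.ToType := by
  have hcard : o.card = o.cof := by rw [← Cardinal.card_ord o.cof, h]
  rw [Ordinal.cof_toType, ← hcard, ← Cardinal.mk_toType]
  exact Cardinal.mk_Iio_lt i (by rw [Cardinal.mk_toType, hcard, h, Ordinal.type_toType])

/-! ### Club sets and club guessing -/

/-- Every well-order has a club set of cardinality at most its cofinality. -/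
theorem exists_isClub_mk_le_cof (α : Type u) [LinearOrder α] [WellFoundedLT α] [NoMaxOrder α] :
    ∃ s : Set α, IsClub s ∧ #s ≤ Order.cof α := by
  obtain ⟨A, hA, hA'⟩ := Order.exists_cof_eq α
  have hne (a : α) : {x | ∀ b ∈ A, b < a → b < x}.Nonempty := ⟨a, fun b _ h ↦ h⟩
  -- `t a` is the supremum of the successors of members of `A` below `a`. Replacing `A` by these
  -- suprema makes it closed.
  choose t ht using fun a ↦ exists_isLeast_of_nonempty (hne a)
  have hle (a : α) : t a ≤ a := (ht a).2 fun b _ h ↦ h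
  have hlt {a b : α} (hb : b ∈ A) (h : b < a) : b < t a := (ht a).1 b hb h
  have hmono {a b : α} (h : a ≤ b) : t a ≤ t b := (ht a).2 fun c hc hca ↦ hlt hc (hca.trans_le h)
  refine ⟨t '' A, ⟨fun B hB hB₀ _ x hx ↦ ?_, fun x ↦ ?_⟩, Cardinal.mk_image_le.trans hA'.le⟩
  · obtain ⟨y, hyA, hy⟩ := hA x
    -- The supremum `x` equals `t a` for the least `a ∈ A` with `x ≤ a`.
    obtain ⟨a, ⟨haA, hxa⟩, ha⟩ := exists_isLeast_of_nonempty (s := {a | a ∈ A ∧ x ≤ a}) ⟨y, hyA, hy⟩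
    refine ⟨a, haA, le_antisymm ((ht a).2 fun b hb hba ↦ ?_) (hx.2 fun z hz ↦ ?_)⟩
    · exact lt_of_not_ge fun h ↦ (ha ⟨hb, h⟩).not_gt hba
    · obtain ⟨b, hb, rfl⟩ := hB hz
      refine hmono (le_of_not_gt fun hab ↦ ?_)
      exact ((hlt haA hab).trans_le (hx.1 hz)).not_ge hxa
  · obtain ⟨y, hy⟩ := exists_gt x
    obtain ⟨a, ha, hya⟩ := hA x
    obtain ⟨z, hz⟩ := exists_gt a
    obtain ⟨b, hb, hzb⟩ := hA z
    exact ⟨t b, ⟨b, hb, rfl⟩, hya.trans (hlt ha (hz.trans_le hzb)).le⟩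

/-- Below some point of cofinality `κ`, a cofinal set `s` is cofinal, if `κ` is regular and smaller
than the cofinality. -/
theorem IsCofinal.exists_cof_Iio_eq {α : Type u} [LinearOrder α] [WellFoundedLT α] [NoMaxOrder α]
    {s : Set α} (hs : IsCofinal s) {κ : Cardinal.{u}} (hκ : κ.IsRegular) (h : κ < Order.cof α) :
    ∃ x : α, Order.cof (Set.Iio x) = κ ∧ ∀ y < x, ∃ z ∈ s, y < z ∧ z < x := by
  have hord : κ.ord.cof.ord = κ.ord := by rw [hκ.cof_ord]
  have hcof : Order.cof κ.ord.ToType = κ := by rw [Ordinal.cof_toType, hκ.cof_ord]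
  have : NoMaxOrder κ.ord.ToType := Cardinal.noMaxOrder hκ.aleph0_le
  have : Nonempty κ.ord.ToType := by
    rw [← Order.cof_ne_zero_iff, hcof]; exact hκ.ne_zero
  have hα : Nonempty α := Order.cof_ne_zero_iff.1 (fun h' ↦ by simp [h'] at h)
  have hgt (b : α) : ∃ c ∈ s, b < c := by
    obtain ⟨d, hd⟩ := exists_gt b
    obtain ⟨c, hc, hdc⟩ := hs d
    exact ⟨c, hc, hd.trans_le hdc⟩
  obtain ⟨e, he⟩ := exists_transfinite_sequence (ι := κ.ord.ToType) (β := α)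
    (fun i δ b ↦ b ∈ s ∧ ∀ j < i, δ j < b)
    (fun i δ ↦ by
      obtain ⟨b, hb⟩ := exists_forall_apply_lt_of_mk_lt_cof
        (((mk_Iio_lt_cof hord i).trans_eq hcof).trans h) (fun j ↦ δ j)
      obtain ⟨c, hc, hbc⟩ := hgt b
      exact ⟨c, hc, fun j hj ↦ (hb ⟨j, hj⟩).trans hbc⟩)
    (fun i δ δ' b hδ hb ↦ ⟨hb.1, fun j hj ↦ hδ j hj ▸ hb.2 j hj⟩)
  have hmono : StrictMono e := fun i j hij ↦ (he j).2 i hij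
  obtain ⟨b, hb⟩ := exists_forall_apply_lt_of_mk_lt_cof
    (by rwa [Cardinal.mk_toType, Cardinal.card_ord]) e
  obtain ⟨x, hx⟩ := exists_isLUB_of_forall_le (s := Set.range e) (b := b)
    (by rintro _ ⟨i, rfl⟩; exact (hb i).le)
  have hlt (i) : e i < x := by
    obtain ⟨j, hj⟩ := exists_gt i
    exact (hmono hj).trans_le (hx.1 ⟨j, rfl⟩)
  have hex (y) (hy : y < x) : ∃ i, y < e i := by
    obtain ⟨_, ⟨i, rfl⟩, hi⟩ := (lt_isLUB_iff hx).1 hy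
    exact ⟨i, hi⟩
  refine ⟨x, ?_, fun y hy ↦ ?_⟩
  · rw [← hcof]
    refine (Order.cof_congr_of_strictMono (f := fun i ↦ (⟨e i, hlt i⟩ : Set.Iio x))
      (fun i j hij ↦ hmono hij) fun y ↦ ?_).symm
    obtain ⟨i, hi⟩ := hex y y.2
    exact ⟨_, ⟨i, rfl⟩, hi.le⟩
  · obtain ⟨i, hi⟩ := hex y hy
    exact ⟨e i, (he i).1, hi, hlt i⟩

theorem IsClub.preimage_Iio {α : Type u} [LinearOrder α] {s : Set α} (hs : IsClub s) {x : α}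
    (hx : ∀ y < x, ∃ z ∈ s, y < z ∧ z < x) : IsClub (Subtype.val ⁻¹' s : Set (Set.Iio x)) := by
  refine ⟨fun B hB hB₀ _ y hy ↦ ?_, fun y ↦ ?_⟩
  · refine hs.isLUB_mem (t := Subtype.val '' B) ?_ (hB₀.image _) ⟨?_, fun z hz ↦ ?_⟩
    · rintro _ ⟨b, hb, rfl⟩; exact hB hb
    · rintro _ ⟨b, hb, rfl⟩; exact hy.1 hb
    · refine le_of_not_gt fun hzy ↦ ?_
      have : y ≤ ⟨z, hzy.trans y.2⟩ := hy.2 fun b hb ↦ hz ⟨b, hb, rfl⟩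
      exact hzy.not_ge this
  · obtain ⟨z, hz, hyz, hzx⟩ := hx y y.2
    exact ⟨⟨z, hzx⟩, hz, hyz.le⟩

/-- Shelah's club guessing for points of cofinality `ω₁` in a well-order of cofinality `ω₃`. -/
theorem exists_club_guessing {α : Type u} [LinearOrder α] [WellFoundedLT α]
    (hα : Order.cof α = ℵ_ 3) :
    ∃ C : α → Set α, ∀ F : Set α, IsClub F → ∃ γ, C γ ⊆ F ∧ ¬ (C γ).Countable ∧
      ∀ i ∈ C γ, ∃ j ∈ C γ, i < j := by
  classical
  have hα0 : ℵ₀ < Order.cof α := by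
    rw [hα, ← Cardinal.aleph_zero]; exact Cardinal.aleph_lt_aleph.2 (by norm_num)
  have hreg1 : (ℵ_ 1).IsRegular := Cardinal.isRegular_aleph_one
  have hreg2 : (ℵ_ 2).IsRegular := by
    have := Cardinal.isRegular_aleph_add_one 1
    rwa [one_add_one_eq_two] at this
  have h13 : ℵ_ 1 < Order.cof α := by rw [hα]; exact Cardinal.aleph_lt_aleph.2 (by norm_num)
  have h23 : ℵ_ 2 < Order.cof α := by rw [hα]; exact Cardinal.aleph_lt_aleph.2 (by norm_num)
  have h12 : ℵ_ 1 < ℵ_ 2 := Cardinal.aleph_lt_aleph.2 (by norm_num)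
  have : Nonempty α := Order.cof_ne_zero_iff.1 (fun h' ↦ by simp [h'] at hα0)
  have : NoMaxOrder α := by
    rw [← noTopOrder_iff_noMaxOrder, ← Order.one_lt_cof_iff]
    exact Cardinal.one_lt_aleph0.trans hα0
  let G (x : α) : Prop := Order.cof (Set.Iio x) = ℵ_ 1
  have hnomax {x : α} (hx : G x) : NoMaxOrder (Set.Iio x) := by
    have : Nonempty (Set.Iio x) := Order.cof_ne_zero_iff.1 (by rw [hx]; exact hreg1.ne_zero)
    rw [← noTopOrder_iff_noMaxOrder, ← Order.one_lt_cof_iff, hx]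
    exact Cardinal.one_lt_aleph0.trans_le hreg1.aleph0_le
  have hA (x : α) : ∃ A : Set (Set.Iio x), G x → IsClub A ∧ #A ≤ ℵ_ 1 := by
    by_cases hx : G x
    · have := hnomax hx
      obtain ⟨A, hA, hA'⟩ := exists_isClub_mk_le_cof (Set.Iio x)
      exact ⟨A, fun _ ↦ ⟨hA, hA'.trans_eq hx⟩⟩
    · exact ⟨∅, fun h ↦ (hx h).elim⟩
  choose A hA using hA
  let Acc (E : Set α) (x : α) : Prop := G x ∧ ∀ y < x, ∃ z ∈ E, y < z ∧ z < x
  let C (E : Set α) (x : α) : Set α := (Subtype.val '' A x) ∩ E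
  suffices H : ∃ E : Set α, IsClub E ∧ ∀ F : Set α, IsClub F → ∃ x, Acc E x ∧ C E x ⊆ F by
    obtain ⟨E, hE, H⟩ := H
    refine ⟨C E, fun F hF ↦ ?_⟩
    obtain ⟨x, hx, hxF⟩ := H F hF
    have hcl := ((hA x hx.1).1.inter (by rw [hx.1]; exact
      (Cardinal.aleph0_lt_aleph_one).ne') (hE.preimage_Iio hx.2)).isCofinal
    have hC : C E x = Subtype.val '' (A x ∩ Subtype.val ⁻¹' E) := by
      ext y; simp only [C, Set.mem_inter_iff, Set.mem_image, Set.mem_preimage]; grind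
    refine ⟨x, hxF, fun hcount ↦ ?_, fun i hi ↦ ?_⟩
    · rw [hC] at hcount
      replace hcount := Set.countable_of_injective_of_countable_image
        Subtype.val_injective.injOn hcount
      rw [← Cardinal.le_aleph0_iff_set_countable] at hcount
      have := (Order.cof_le hcl).trans hcount
      rw [hx.1] at this
      exact this.not_gt Cardinal.aleph0_lt_aleph_one
    · rw [hC] at hi ⊢
      obtain ⟨y, hy, rfl⟩ := hi
      have := hnomax hx.1
      obtain ⟨z, hz⟩ := exists_gt y
      obtain ⟨w, hw, hzw⟩ := hcl z
      exact ⟨w, ⟨w, hw, rfl⟩, hz.trans_le hzw⟩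
  -- If every club `E` fails to guess some club `F E`, shrink `E` by `F E` again and again, ω_2
  -- times.
  by_contra! H
  choose! F hF hFE using H
  have hord : (ℵ_ 2 : Cardinal.{u}).ord.cof.ord = (ℵ_ 2 : Cardinal.{u}).ord := by rw [hreg2.cof_ord]
  let ι := (ℵ_ 2 : Cardinal.{u}).ord.ToType
  have hιcof : Order.cof ι = ℵ_ 2 := by rw [Ordinal.cof_toType, hreg2.cof_ord]
  obtain ⟨E, hE⟩ := exists_transfinite_sequence (ι := ι) (β := Set α)
    (fun i δ b ↦ b = ⋂ j : Set.Iio i, (δ j ∩ F (δ j))) (fun i δ ↦ ⟨_, rfl⟩)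
    (fun i δ δ' b hδ hb ↦ by
      rw [hb]
      exact Set.iInter_congr fun j ↦ by rw [hδ j j.2])
  have hclub (i : ι) : IsClub (E i) := by
    induction i using WellFoundedLT.induction with
    | ind i ih =>
      rw [hE i]
      refine IsClub.iInter hα0.ne' ?_ fun j ↦ ?_
      · rw [Cardinal.lift_id, Cardinal.lift_id]
        exact ((mk_Iio_lt_cof hord i).trans_eq hιcof).trans h23
      · exact (ih j j.2).inter hα0.ne' (hF _ (ih j j.2))
  have hsub {i j : ι} (hij : i < j) : E j ⊆ E i ∩ F (E i) := by
    rw [hE j]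
    exact Set.iInter_subset (fun j : Set.Iio j ↦ E j ∩ F (E j)) ⟨i, hij⟩
  have hall : IsClub (⋂ i, E i) := IsClub.iInter hα0.ne'
    (by rw [Cardinal.lift_id, Cardinal.lift_id, Cardinal.mk_toType, Cardinal.card_ord]; exact h23)
    hclub
  obtain ⟨x, hx, hacc⟩ := hall.isCofinal.exists_cof_Iio_eq hreg1 h13
  -- Each point of `A x` that is ever dropped is dropped at some stage below ω_2. As `A x` has only
  -- ℵ_1 points, from some stage `i` on the trace of `E i` on `A x` is constant, hence contained in
  -- `F (E i)`.
  have hdrop (a : α) : ∃ i : ι, (∃ j, a ∉ E j) → a ∉ E i := by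
    by_cases h : ∃ j, a ∉ E j
    · obtain ⟨j, hj⟩ := h; exact ⟨j, fun _ ↦ hj⟩
    · have : Nonempty ι := Order.cof_ne_zero_iff.1 (by rw [hιcof]; exact hreg2.ne_zero)
      exact ⟨this.some, fun h' ↦ (h h').elim⟩
  choose d hd using hdrop
  obtain ⟨i, hi⟩ := exists_forall_apply_lt_of_mk_lt_cof (α := ι)
    (((hA x hx).2.trans_lt h12).trans_eq hιcof.symm) (fun a ↦ d a)
  refine hFE (E i) (hclub i) x ⟨hx, fun y hy ↦ ?_⟩ ?_
  · obtain ⟨z, hz, h⟩ := hacc y hy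
    exact ⟨z, Set.mem_iInter.1 hz i, h⟩
  · rintro _ ⟨⟨a, ha, rfl⟩, hai⟩
    have : NoMaxOrder ι := Cardinal.noMaxOrder hreg2.aleph0_le
    obtain ⟨j, hj⟩ := exists_gt i
    by_contra haF
    refine hd a ⟨j, fun h ↦ haF (hsub hj h).2⟩ ?_
    exact (hsub (hi ⟨a, ha⟩) hai).1

/-! ### Increasing sequences in the product of the ω_(n+5) -/

/-- The sequence `ω₅, ω₆, ω₇, …` of regular initial ordinals. -/
noncomputable def omegaAddFive (n : ℕ) : Ordinal.{0} := ω_ (((n + 4 : ℕ) : Ordinal) + 1)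

theorem aleph_lt_cof_omegaAddFive {m n : ℕ} (h : m ≤ n + 4) :
    ℵ_ (m : Ordinal) < (omegaAddFive n).cof := by
  rw [omegaAddFive, Cardinal.cof_omega_add_one]
  refine Cardinal.aleph_lt_aleph.2 (lt_of_le_of_lt (Nat.cast_le.2 h) ?_)
  exact Order.lt_add_one_iff.2 le_rfl

theorem omegaAddFive_pos (n : ℕ) : 0 < omegaAddFive n := Ordinal.omega_pos _

theorem iSup_add_one_lt_omegaAddFive {ι : Type} {n : ℕ} (hι : #ι ≤ ℵ_ ((n + 4 : ℕ) : Ordinal))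
    {g : ι → Ordinal.{0}} (hg : ∀ i, g i < omegaAddFive n) : ⨆ i, (g i + 1) < omegaAddFive n :=
  Ordinal.iSup_add_one_lt_of_lt_cof (hι.trans_lt (aleph_lt_cof_omegaAddFive le_rfl)) hg

theorem aleph_natCast_mono {m n : ℕ} (h : m ≤ n) :
    ℵ_ (m : Ordinal) ≤ ℵ_ (n : Ordinal) :=
  Cardinal.aleph_le_aleph.2 (Nat.cast_le.2 h)

/-- At most `ℵ_ω` elements of `∏ ω_(n+5)` have an upper bound modulo finite. -/
theorem exists_eventually_gt_of_mk_le_aleph_omega {ι : Type} (hι : #ι ≤ ℵ_ ω)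
    (g : ι → ℕ → Ordinal.{0}) (hg : ∀ i n, g i n < omegaAddFive n) :
    ∃ b : ℕ → Ordinal.{0}, (∀ n, b n < omegaAddFive n) ∧
      ∀ i, ∀ᶠ n in Filter.cofinite, g i n < b n := by
  have hι' : #ι ≤ #(ω_ ω).ToType := by rwa [Cardinal.mk_toType, Ordinal.card_omega]
  obtain ⟨e⟩ := Cardinal.le_def _ _ |>.1 hι'
  let r (i : ι) : Ordinal.{0} := Ordinal.ToType.mk.symm (e i)
  have hr : Function.Injective r :=
    Subtype.val_injective.comp (Ordinal.ToType.mk.symm.injective.comp e.injective)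
  have hrlt (i : ι) : ∃ n : ℕ, r i < ω_ (n : Ordinal) := by
    have h : r i < ω_ ω := (Ordinal.ToType.mk.symm (e i)).2
    obtain ⟨o, ho, h'⟩ := (Ordinal.isNormal_omega.lt_iff_exists_lt Ordinal.isSuccLimit_omega0).1 h
    obtain ⟨n, rfl⟩ := Ordinal.lt_omega0.1 ho
    exact ⟨n, h'⟩
  have hcard (n : ℕ) : #{i // r i < ω_ (n : Ordinal)} ≤ ℵ_ (n : Ordinal) := by
    rw [← Ordinal.card_omega, ← Cardinal.mk_toType]
    exact Cardinal.mk_le_of_injective (f := fun i ↦ Ordinal.ToType.mk ⟨r i, i.2⟩)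
      fun i j h ↦ by
        have h' := Ordinal.ToType.mk.injective h
        exact Subtype.ext (hr (Subtype.mk.inj h'))
  -- Coordinate `n` handles only the at most ℵ_n indices of rank below ω_n; each index is handled
  -- from some coordinate on.
  refine ⟨fun n ↦ ⨆ i : {i // r i < ω_ (n : Ordinal)}, (g i n + 1), fun n ↦ ?_, fun i ↦ ?_⟩
  · exact iSup_add_one_lt_omegaAddFive ((hcard n).trans (aleph_natCast_mono (by omega)))
      fun i ↦ hg i n
  · obtain ⟨m, hm⟩ := hrlt i
    rw [Nat.cofinite_eq_atTop]
    filter_upwards [Filter.eventually_ge_atTop m] with n hn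
    have hin : r i < ω_ (n : Ordinal) := hm.trans_le (Ordinal.omega_le_omega.2 (Nat.cast_le.2 hn))
    exact (Order.lt_add_one_iff.2 le_rfl).trans_le
      (Ordinal.le_iSup (fun i : {i // r i < ω_ (n : Ordinal)} ↦ g i n + 1) ⟨i, hin⟩)

/-- An increasing sequence modulo finite in `∏ ω_(n+5)` that bounds small sets `E ξ` of previous
members everywhere. -/
theorem exists_increasing_sequence_bounding {Λ : Type} [LinearOrder Λ] [WellFoundedLT Λ]
    (hΛ : ∀ ξ : Λ, #(Set.Iio ξ) ≤ ℵ_ ω) (E : ∀ ξ : Λ, Set (Set.Iio ξ))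
    (hE : ∀ ξ, #(E ξ) ≤ ℵ_ ((4 : ℕ) : Ordinal)) :
    ∃ f : Λ → ℕ → Ordinal.{0}, (∀ ξ n, f ξ n < omegaAddFive n) ∧
      (∀ η ξ, η < ξ → ∀ᶠ n in Filter.cofinite, f η n < f ξ n) ∧
      ∀ ξ, ∀ η ∈ E ξ, ∀ n, f η n ≤ f ξ n := by
  let β := {b : ℕ → Ordinal.{0} // ∀ n, b n < omegaAddFive n}
  have : Nonempty β := ⟨⟨fun _ ↦ 0, omegaAddFive_pos⟩⟩
  obtain ⟨f, hf⟩ := exists_transfinite_sequence (ι := Λ) (β := β)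
    (fun ξ δ b ↦ (∀ η < ξ, ∀ᶠ n in Filter.cofinite, (δ η).1 n < b.1 n) ∧
      ∀ η ∈ E ξ, ∀ n, (δ η).1 n ≤ b.1 n)
    (fun ξ δ ↦ by
      obtain ⟨b, hb, hb'⟩ := exists_eventually_gt_of_mk_le_aleph_omega (hΛ ξ)
        (fun η n ↦ (δ η).1 n) fun η n ↦ (δ η).2 n
      -- `b` takes care of all predecessors modulo finite; the supremum takes care of `E ξ` at every
      -- coordinate, which is possible since all cofinalities exceed ℵ_4.
      refine ⟨⟨fun n ↦ max (b n) (⨆ η : E ξ, ((δ η).1 n + 1)), fun n ↦ ?_⟩,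
        fun η hη ↦ ?_, fun η hη n ↦ ?_⟩
      · exact max_lt (hb n) (iSup_add_one_lt_omegaAddFive
          ((hE ξ).trans (aleph_natCast_mono (by omega))) fun η ↦ (δ η).2 n)
      · filter_upwards [hb' ⟨η, hη⟩] with n hn
        exact hn.trans_le (le_max_left _ _)
      · refine le_trans ?_ (le_max_right _ _)
        exact (Order.lt_add_one_iff.2 le_rfl).le.trans
          (Ordinal.le_iSup (fun η : E ξ ↦ (δ η).1 n + 1) ⟨η, hη⟩))
    (fun ξ δ δ' b hδ hb ↦ ⟨fun η hη ↦ hδ η hη ▸ hb.1 η hη,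
      fun η hη ↦ hδ η η.2 ▸ hb.2 η hη⟩)
  exact ⟨fun ξ ↦ (f ξ).1, fun ξ ↦ (f ξ).2, fun η ξ h ↦ (hf ξ).1 η h, fun ξ ↦ (hf ξ).2⟩

/-! ### The bounding projection property -/

/-- The preimage of a club set under a normal function is a club set. -/
theorem IsClub.preimage_of_normal {α Λ : Type u} [LinearOrder α] [WellFoundedLT α]
    [LinearOrder Λ] [WellFoundedLT Λ] (hα : ℵ₀ < Order.cof α) {x : Λ} {δ : α → Set.Iio x}
    (hδ : StrictMono δ) (hcof : IsCofinal (Set.range δ))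
    (hlub : ∀ (B : Set α) i, B.Nonempty → IsLUB B i → IsLUB (δ '' B) (δ i))
    {E : Set (Set.Iio x)} (hE : IsClub E) : IsClub (δ ⁻¹' E) := by
  have hcof' : Order.cof α = Order.cof (Set.Iio x) := Order.cof_congr_of_strictMono hδ hcof
  have hα0 : Nonempty α := Order.cof_ne_zero_iff.1 (fun h' ↦ by simp [h'] at hα)
  have : NoMaxOrder α := by
    rw [← noTopOrder_iff_noMaxOrder, ← Order.one_lt_cof_iff]
    exact Cardinal.one_lt_aleph0.trans hα
  have hrange : IsClub (Set.range δ) := by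
    refine ⟨fun T hT hT₀ _ y hy ↦ ?_, hcof⟩
    obtain ⟨_, ⟨i, rfl⟩, hi⟩ := hcof y
    have himg : δ '' (δ ⁻¹' T) = T := Set.image_preimage_eq_of_subset hT
    obtain ⟨j, hj⟩ := exists_isLUB_of_forall_le (s := δ ⁻¹' T) (b := i) fun a ha ↦
      hδ.le_iff_le.1 ((hy.1 ha).trans hi)
    have hne : (δ ⁻¹' T).Nonempty := by
      rw [← himg] at hT₀; exact hT₀.of_image
    have := hlub _ _ hne hj
    rw [himg] at this
    exact ⟨j, this.unique hy⟩
  refine ⟨fun B hB hB₀ _ i hi ↦ ?_, fun i ↦ ?_⟩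
  · exact hE.isLUB_mem (Set.image_subset_iff.2 hB) (hB₀.image _) (hlub B i hB₀ hi)
  · have := (hE.inter (by rw [← hcof']; exact hα.ne') hrange).isCofinal
    obtain ⟨_, ⟨hy, ⟨j, rfl⟩⟩, hij⟩ := this (δ i)
    exact ⟨j, hy, hδ.le_iff_le.1 hij⟩

/-- The least element of `S` that is at least `a`. -/
noncomputable def leastAbove (S : Set Ordinal.{0}) (a : Ordinal.{0}) : Ordinal.{0} :=
  sInf {s | s ∈ S ∧ a ≤ s}

theorem leastAbove_mem {S : Set Ordinal.{0}} {a : Ordinal.{0}} (h : ∃ s ∈ S, a ≤ s) :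
    leastAbove S a ∈ S :=
  (csInf_mem (s := {s | s ∈ S ∧ a ≤ s}) h).1

theorem le_leastAbove {S : Set Ordinal.{0}} {a : Ordinal.{0}} (h : ∃ s ∈ S, a ≤ s) :
    a ≤ leastAbove S a :=
  (csInf_mem (s := {s | s ∈ S ∧ a ≤ s}) h).2

theorem leastAbove_le {S : Set Ordinal.{0}} {a s : Ordinal.{0}} (hs : s ∈ S) (h : a ≤ s) :
    leastAbove S a ≤ s :=
  csInf_le' ⟨hs, h⟩

/-- An increasing sequence that bounds clubs of its initial segments of cofinality `ω₃` has the
bounding projection property for countable sets. -/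
theorem exists_forall_eventually_le_leastAbove {Λ : Type} [LinearOrder Λ] [WellFoundedLT Λ]
    (hΛ : ℵ_ 3 < Order.cof Λ) (E : ∀ ξ : Λ, Set (Set.Iio ξ))
    (hE : ∀ ξ, Order.cof (Set.Iio ξ) = ℵ_ 3 → IsClub (E ξ)) (D : Ultrafilter ℕ)
    (f : Λ → ℕ → Ordinal.{0}) (hf : ∀ η ξ, η < ξ → ∀ᶠ n in D, f η n < f ξ n)
    (hfE : ∀ ξ, ∀ η ∈ E ξ, ∀ n, f η n ≤ f ξ n) (S : ℕ → Set Ordinal.{0})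
    (hS : ∀ n, (S n).Countable) (hSf : ∀ ξ n, ∃ s ∈ S n, f ξ n ≤ s) :
    ∃ ξ, ∀ η, ∀ᶠ n in D, f η n ≤ leastAbove (S n) (f ξ n) := by
  by_contra! H
  have hjump (ξ : Λ) : ∃ η, ∀ᶠ n in D, leastAbove (S n) (f ξ n) < f η n := by
    obtain ⟨η, hη⟩ := H ξ
    refine ⟨η, ?_⟩
    simpa using hη
  choose nxt hnxt using hjump
  have hreg : (ℵ_ 3 : Cardinal.{0}).IsRegular := by
    have := Cardinal.isRegular_aleph_add_one 2
    rwa [two_add_one_eq_three] at this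
  have hord : (ℵ_ 3 : Cardinal.{0}).ord.cof.ord = (ℵ_ 3 : Cardinal.{0}).ord := by rw [hreg.cof_ord]
  let α := (ℵ_ 3 : Cardinal.{0}).ord.ToType
  have hαcof : Order.cof α = ℵ_ 3 := by rw [Ordinal.cof_toType, hreg.cof_ord]
  have hαmk : #α = ℵ_ 3 := by rw [Cardinal.mk_toType, Cardinal.card_ord]
  have hα0 : ℵ₀ < Order.cof α := by
    rw [hαcof, ← Cardinal.aleph_zero]; exact Cardinal.aleph_lt_aleph.2 (by norm_num)
  have : NoMaxOrder α := Cardinal.noMaxOrder hreg.aleph0_le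
  have hΛne : Nonempty Λ := Order.cof_ne_zero_iff.1 (fun h' ↦ by simp [h'] at hΛ)
  obtain ⟨C, hC⟩ := exists_club_guessing hαcof
  -- One set of coordinates in `D` must work for all `i` at once. The everywhere bounds `hfE` will
  -- provide this.
  let Bd (δ : α → Λ) (γ j : α) (ξ : Λ) : Prop :=
    ∀ᶠ n in D, ∀ i ∈ C γ, i ≤ j → f (δ i) n ≤ f ξ n
  -- The recursion cannot know the club of its own supremum in advance, so it anticipates every
  -- guess `C γ`. There are only ℵ_3 of them, fewer than the cofinality of `Λ`.
  let R (δ : α → Λ) (j : α) (b : Λ) : Prop :=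
    δ j < b ∧ ∀ γ, (∃ ξ, Bd δ γ j ξ) →
      ∃ ξ, Bd δ γ j ξ ∧ ∀ᶠ n in D, leastAbove (S n) (f ξ n) < f b n
  have hRmono {δ j} {b c : Λ} (hbc : b ≤ c) (hb : R δ j b) : R δ j c := by
    obtain rfl | hbc := hbc.eq_or_lt
    · exact hb
    refine ⟨hb.1.trans hbc, fun γ hγ ↦ ?_⟩
    obtain ⟨ξ, hξ, hξ'⟩ := hb.2 γ hγ
    exact ⟨ξ, hξ, by filter_upwards [hξ', hf b c hbc] with n h₁ h₂ using h₁.trans h₂⟩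
  have hRex (δ j) : ∃ b, R δ j b := by
    have hch (γ : α) : ∃ ξ, (∃ ξ, Bd δ γ j ξ) → Bd δ γ j ξ := by
      by_cases h : ∃ ξ, Bd δ γ j ξ
      · exact ⟨h.choose, fun _ ↦ h.choose_spec⟩
      · exact ⟨hΛne.some, fun h' ↦ (h h').elim⟩
    choose ξ hξ using hch
    obtain ⟨b, hb⟩ := exists_forall_apply_lt_of_mk_lt_cof (hαmk.trans_lt hΛ)
      (fun γ ↦ max (δ j) (nxt (ξ γ)))
    refine ⟨b, (le_max_left _ _).trans_lt (hb j), fun γ hγ ↦ ⟨ξ γ, hξ γ hγ, ?_⟩⟩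
    filter_upwards [hnxt (ξ γ), hf _ b ((le_max_right _ _).trans_lt (hb γ))] with n h₁ h₂
    exact h₁.trans h₂
  have hRcongr {δ δ' : α → Λ} {j b} (h : ∀ i ≤ j, δ i = δ' i) (hR : R δ j b) : R δ' j b := by
    have hBd (γ ξ) : Bd δ γ j ξ ↔ Bd δ' γ j ξ := by
      refine Filter.eventually_congr (.of_forall fun n ↦ ?_)
      exact forall₃_congr fun i _ hi ↦ by rw [h i hi]
    simpa only [R, hBd, h j le_rfl] using hR
  obtain ⟨δ, hδ⟩ := exists_transfinite_sequence (ι := α) (β := Λ)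
    -- Taking the least candidate makes `δ` continuous, so that clubs below its supremum pull back
    -- to clubs.
    (fun i δ b ↦ IsLeast {b | ∀ j < i, R δ j b} b)
    (fun i δ ↦ by
      choose b hb using hRex δ
      obtain ⟨c, hc⟩ := exists_forall_apply_lt_of_mk_lt_cof (hαmk.trans_lt hΛ) b
      exact exists_isLeast_of_nonempty ⟨c, fun j _ ↦ hRmono (hc j).le (hb j)⟩)
    (fun i δ δ' b h hb ↦ by
      convert hb using 3
      refine forall₂_congr fun j hj ↦ ⟨hRcongr fun k hk ↦ (h k (hk.trans_lt hj)).symm,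
        hRcongr fun k hk ↦ h k (hk.trans_lt hj)⟩)
  have hδmono : StrictMono δ := fun i j hij ↦ ((hδ j).1 i hij).1
  obtain ⟨b, hb⟩ := exists_forall_apply_lt_of_mk_lt_cof (hαmk.trans_lt hΛ) δ
  obtain ⟨x, hx⟩ := exists_isLUB_of_forall_le (s := Set.range δ) (b := b)
    (by rintro _ ⟨i, rfl⟩; exact (hb i).le)
  have hlt (i) : δ i < x := by
    obtain ⟨j, hj⟩ := exists_gt i
    exact (hδmono hj).trans_le (hx.1 ⟨j, rfl⟩)
  let ε (i : α) : Set.Iio x := ⟨δ i, hlt i⟩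
  have hεmono : StrictMono ε := fun i j hij ↦ hδmono hij
  have hεcof : IsCofinal (Set.range ε) := fun y ↦ by
    obtain ⟨_, ⟨i, rfl⟩, hi⟩ := (lt_isLUB_iff hx).1 y.2
    exact ⟨_, ⟨i, rfl⟩, hi.le⟩
  have hxcof : Order.cof (Set.Iio x) = ℵ_ 3 := by
    rw [← hαcof, Order.cof_congr_of_strictMono hεmono hεcof]
  have hclub : IsClub (ε ⁻¹' E x) := by
    refine (hE x hxcof).preimage_of_normal hα0 hεmono hεcof fun B i _ hi ↦ ⟨?_, fun y hy ↦ ?_⟩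
    · rintro _ ⟨j, hj, rfl⟩
      exact hεmono.monotone (hi.1 hj)
    · refine (hδ i).2 fun j hj ↦ ?_
      obtain ⟨k, hk, hjk⟩ := (lt_isLUB_iff hi).1 hj
      exact hRmono (hy ⟨k, hk, rfl⟩) ((hδ k).1 j hjk)
  obtain ⟨γ, hγ, hγ', hγ''⟩ := hC _ hclub
  have hBdx (j) : ∃ ξ, Bd δ γ j ξ :=
    ⟨x, .of_forall fun n i hi _ ↦ hfE x _ (hγ hi) n⟩
  -- `k` is the successor of `j` in `C γ`: the rounding of a bound for the part up to `j` is already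
  -- below `f (δ k)`.
  have hstep (j : C γ) : ∃ ξ : Λ, ∃ k : α, ∃ n : ℕ, (∀ i ∈ C γ, i ≤ j → f (δ i) n ≤ f ξ n) ∧
      leastAbove (S n) (f ξ n) < f (δ k) n ∧ k ∈ C γ ∧ ∀ i ∈ C γ, j < i → k ≤ i := by
    obtain ⟨k, ⟨hk, hjk⟩, hk'⟩ := exists_isLeast_of_nonempty (s := {k | k ∈ C γ ∧ j < k})
      (hγ'' j j.2)
    obtain ⟨ξ, hξ, hξ'⟩ := ((hδ k).1 j hjk).2 γ (hBdx j)
    obtain ⟨n, h₁, h₂⟩ := (hξ.and hξ').exists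
    exact ⟨ξ, k, n, h₁, h₂, hk, fun i hi hji ↦ hk' ⟨hi, hji⟩⟩
  choose ξ k ν hν₁ hν₂ hk hk' using hstep
  have hfib : ∃ n, ¬ {j : C γ | ν j = n}.Countable := by
    by_contra! h
    refine hγ' ((Set.countable_coe_iff).1 (Set.countable_univ_iff.1 ?_))
    refine (Set.countable_iUnion h).mono fun j _ ↦ Set.mem_iUnion.2 ⟨ν j, rfl⟩
  -- At one coordinate `n`, uncountably many `j` have roundings in the countable set `S n`, yet
  -- these roundings strictly increase with `j`.
  obtain ⟨n, hn⟩ := hfib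
  refine hn ?_
  refine Set.MapsTo.countable_of_injOn (f := fun j ↦ leastAbove (S n) (f (ξ j) n)) (t := S n)
    (fun j _ ↦ leastAbove_mem (hSf _ _)) ?_ (hS n)
  refine StrictMonoOn.injOn fun i hi j hj hij ↦ ?_
  simp only [Set.mem_ofPred_eq] at hi hj
  have h₁ := hν₂ i
  have h₂ := hν₁ j (k i) (hk i) (hk' i j j.2 hij)
  rw [hi] at h₁
  rw [hj] at h₂
  exact (h₁.trans_le h₂).trans_le (le_leastAbove (hSf _ _))

/-! ### Exact upper bounds and the scale of length ω_{ω+1} -/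

theorem leastAbove_mono {S : Set Ordinal.{0}} {a b : Ordinal.{0}} (hab : a ≤ b)
    (h : ∃ s ∈ S, b ≤ s) : leastAbove S a ≤ leastAbove S b :=
  leastAbove_le (leastAbove_mem h) (hab.trans (le_leastAbove h))

/-- A sequence with the bounding projection property for countable sets has a least upper bound
modulo an ultrafilter. -/
theorem exists_eventually_lub {Λ : Type} [LinearOrder Λ] (hΛ : ℵ_ 1 < Order.cof Λ)
    (D : Ultrafilter ℕ) (f : Λ → ℕ → Ordinal.{0})
    (hf : ∀ η ξ, η < ξ → ∀ᶠ n in D, f η n < f ξ n) (τ : ℕ → Ordinal.{0})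
    (hτ : ∀ ξ n, f ξ n ≤ τ n)
    (hproj : ∀ S : ℕ → Set Ordinal.{0}, (∀ n, (S n).Countable) →
      (∀ ξ n, ∃ s ∈ S n, f ξ n ≤ s) →
      ∃ ξ, ∀ η, ∀ᶠ n in D, f η n ≤ leastAbove (S n) (f ξ n)) :
    ∃ g : ℕ → Ordinal.{0}, (∀ ξ, ∀ᶠ n in D, f ξ n ≤ g n) ∧
      ∀ u : ℕ → Ordinal.{0}, (∀ ξ, ∀ᶠ n in D, f ξ n ≤ u n) → ∀ᶠ n in D, g n ≤ u n := by
  by_contra! H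
  replace H : ∀ g : ℕ → Ordinal.{0}, (∀ ξ, ∀ᶠ n in D, f ξ n ≤ g n) →
      ∃ u : ℕ → Ordinal.{0}, (∀ ξ, ∀ᶠ n in D, f ξ n ≤ u n) ∧ ∀ᶠ n in D, u n < g n := by
    intro g hg
    obtain ⟨u, hu, hu'⟩ := H g hg
    exact ⟨u, hu, by simpa using hu'⟩
  have hreg : (ℵ_ 1 : Cardinal.{0}).IsRegular := Cardinal.isRegular_aleph_one
  have hord : (ℵ_ 1 : Cardinal.{0}).ord.cof.ord = (ℵ_ 1 : Cardinal.{0}).ord := by rw [hreg.cof_ord]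
  let α := (ℵ_ 1 : Cardinal.{0}).ord.ToType
  have hαcof : Order.cof α = ℵ_ 1 := by rw [Ordinal.cof_toType, hreg.cof_ord]
  have hαmk : #α = ℵ_ 1 := by rw [Cardinal.mk_toType, Cardinal.card_ord]
  have hIio (i : α) : (Set.Iio i).Countable := by
    rw [← Cardinal.le_aleph0_iff_set_countable, ← Order.lt_succ_iff, Cardinal.succ_aleph0]
    exact (mk_Iio_lt_cof hord i).trans_eq hαcof
  let S (δ : α → ℕ → Ordinal.{0}) (i : α) (n : ℕ) : Set Ordinal.{0} :=
    insert (τ n) ((fun j ↦ δ j n) '' Set.Iio i)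
  have hScount (δ i n) : (S δ i n).Countable := ((hIio i).image _).insert _
  have hSf (δ i ξ n) : ∃ s ∈ S δ i n, f ξ n ≤ s := ⟨τ n, Set.mem_insert _ _, hτ ξ n⟩
  -- Round some `f ξ` up to the earlier values of `δ`. By `hproj` the result is an upper bound, so
  -- by `H` some upper bound lies strictly below it.
  obtain ⟨δ, hδ⟩ := exists_transfinite_sequence (ι := α) (β := ℕ → Ordinal.{0})
    (fun i δ b ↦ (∀ ξ, ∀ᶠ n in D, f ξ n ≤ b n) ∧
      ∃ ξ, ∀ᶠ n in D, b n < leastAbove (S δ i n) (f ξ n))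
    (fun i δ ↦ by
      obtain ⟨ξ, hξ⟩ := hproj (S δ i) (hScount δ i) (hSf δ i)
      obtain ⟨u, hu, hu'⟩ := H _ hξ
      exact ⟨u, hu, ξ, hu'⟩)
    (fun i δ δ' b h hb ↦ by
      have : S δ i = S δ' i := by
        ext1 n
        have himg : (fun j ↦ δ j n) '' Set.Iio i = (fun j ↦ δ' j n) '' Set.Iio i :=
          Set.image_congr fun j hj ↦ congrFun (h j hj) n
        simp only [S, himg]
      rwa [← this])
  choose hδ ξ hξ using hδ
  obtain ⟨ζ, hζ⟩ := exists_forall_apply_lt_of_mk_lt_cof (hαmk.trans_lt hΛ) ξ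
  have hstep (j : α) : ∃ n, δ j n < leastAbove (S δ j n) (f ζ n) ∧ f ζ n ≤ δ j n := by
    obtain ⟨n, h₁, h₂, h₃⟩ := ((hξ j).and ((hf _ _ (hζ j)).and (hδ j ζ))).exists
    exact ⟨n, h₁.trans_le (leastAbove_mono h₂.le (hSf _ _ _ _)), h₃⟩
  choose ν hν₁ hν₂ using hstep
  have hfib : ∃ n, ¬ {j : α | ν j = n}.Countable := by
    by_contra! h
    have huniv : (Set.univ : Set α).Countable :=
      (Set.countable_iUnion h).mono fun j _ ↦ Set.mem_iUnion.2 ⟨ν j, rfl⟩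
    rw [← Cardinal.le_aleph0_iff_set_countable, Cardinal.mk_univ, hαmk] at huniv
    exact huniv.not_gt Cardinal.aleph0_lt_aleph_one
  -- On the uncountable fibre over `n`, the roundings of `f ζ n` to `S δ j n` strictly decrease as
  -- `j` grows, because `δ j n` itself is available at later stages.
  obtain ⟨n, hn⟩ := hfib
  have hne : ((fun j ↦ leastAbove (S δ j n) (f ζ n)) '' {j : α | ν j = n}).Nonempty := by
    refine Set.Nonempty.image _ (Set.nonempty_iff_ne_empty.2 fun h ↦ hn ?_)
    rw [h]; exact Set.countable_empty
  obtain ⟨_, ⟨j, hj, rfl⟩, hmin⟩ := exists_isLeast_of_nonempty hne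
  have hi : ∃ i, ν i = n ∧ j < i := by
    by_contra! h
    refine hn (((hIio j).insert j).mono fun i hi ↦ ?_)
    exact (h i hi).eq_or_lt
  obtain ⟨i, hi, hji⟩ := hi
  have h₁ := hmin ⟨i, hi, rfl⟩
  have hj' : ν j = n := hj
  have h₂ := hν₁ j
  have h₃ := hν₂ j
  rw [hj'] at h₂ h₃
  exact (h₁.trans (leastAbove_le (Set.mem_insert_of_mem _ ⟨j, hji, rfl⟩) h₃)).not_gt h₂

theorem exists_countable_cofinal_of_cof_le {o : Ordinal.{u}} (h : o.cof ≤ ℵ₀) :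
    ∃ s : Set Ordinal.{u}, s.Countable ∧ (∀ a ∈ s, a < o) ∧ ∀ x < o, ∃ a ∈ s, x ≤ a := by
  obtain ⟨s, hs, hs'⟩ := Order.exists_cof_eq (Set.Iio o)
  refine ⟨Subtype.val '' s, Set.Countable.image ?_ _, ?_, fun x hx ↦ ?_⟩
  · rw [← Cardinal.le_aleph0_iff_set_countable, hs', Ordinal.cof_Iio, ← Ordinal.lift_cof,
      Cardinal.lift_le_aleph0]
    exact h
  · rintro _ ⟨a, _, rfl⟩; exact a.2
  · obtain ⟨a, ha, hxa⟩ := hs ⟨x, hx⟩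
    exact ⟨a, ⟨a, ha, rfl⟩, hxa⟩

/-- The least upper bound of a sequence with the bounding projection property has uncountable
cofinalities. -/
theorem eventually_aleph0_lt_cof {Λ : Type}
    (D : Ultrafilter ℕ) (f : Λ → ℕ → Ordinal.{0}) (τ : ℕ → Ordinal.{0})
    (hτ : ∀ ξ n, f ξ n ≤ τ n)
    (hproj : ∀ S : ℕ → Set Ordinal.{0}, (∀ n, (S n).Countable) →
      (∀ ξ n, ∃ s ∈ S n, f ξ n ≤ s) →
      ∃ ξ, ∀ η, ∀ᶠ n in D, f η n ≤ leastAbove (S n) (f ξ n))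
    (g : ℕ → Ordinal.{0}) (hg : ∀ ξ, ∀ᶠ n in D, f ξ n < g n)
    (hg' : ∀ u : ℕ → Ordinal.{0}, (∀ ξ, ∀ᶠ n in D, f ξ n ≤ u n) → ∀ᶠ n in D, g n ≤ u n) :
    ∀ᶠ n in D, ℵ₀ < (g n).cof := by
  by_contra h
  replace h : ∀ᶠ n in D, (g n).cof ≤ ℵ₀ := by
    rw [← Ultrafilter.eventually_not] at h
    simpa using h
  have hC (n : ℕ) : ∃ s : Set Ordinal.{0}, s.Countable ∧
      ((g n).cof ≤ ℵ₀ → (∀ a ∈ s, a < g n) ∧ ∀ x < g n, ∃ a ∈ s, x ≤ a) := by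
    by_cases hn : (g n).cof ≤ ℵ₀
    · obtain ⟨s, hs, hs'⟩ := exists_countable_cofinal_of_cof_le hn
      exact ⟨s, hs, fun _ ↦ hs'⟩
    · exact ⟨∅, Set.countable_empty, fun h' ↦ (hn h').elim⟩
  choose C hC hC' using hC
  -- Rounding `f ξ` up to countable cofinal subsets of the `g n` would give an upper bound below
  -- `g`; `τ n` only ensures that the rounding is always defined.
  obtain ⟨ξ, hξ⟩ := hproj (fun n ↦ insert (τ n) (C n)) (fun n ↦ (hC n).insert _)
    fun ξ n ↦ ⟨τ n, Set.mem_insert _ _, hτ ξ n⟩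
  obtain ⟨n, h₁, h₂, h₃⟩ := (h.and ((hg ξ).and (hg' _ hξ))).exists
  obtain ⟨a, ha, hfa⟩ := (hC' n h₁).2 _ h₂
  exact (h₃.trans (leastAbove_le (Set.mem_insert_of_mem _ ha) hfa)).not_gt ((hC' n h₁).1 a ha)

/-- There is a product of regular cardinals among `ℵ₁, ℵ₂, …` of true cofinality `ℵ_{ω+1}` modulo
an ultrafilter. -/
theorem exists_scale_aleph_omega_add_one :
    ∃ (D : Ultrafilter ℕ) (g : ℕ → Ordinal.{0})
      (f : (ℵ_ (ω + 1) : Cardinal.{0}).ord.ToType → ℕ → Ordinal.{0}),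
      (∀ᶠ n in D, ∃ k : ℕ, 1 ≤ k ∧ (g n).cof = ℵ_ (k : Ordinal)) ∧
      (∀ η ξ, η < ξ → ∀ᶠ n in D, f η n < f ξ n) ∧ (∀ ξ, ∀ᶠ n in D, f ξ n < g n) ∧
      ∀ u : ℕ → Ordinal.{0}, (∀ᶠ n in D, u n < g n) → ∃ ξ, ∀ᶠ n in D, u n < f ξ n := by
  have hreg : (ℵ_ (ω + 1) : Cardinal.{0}).IsRegular := Cardinal.isRegular_aleph_add_one ω
  let Λ := (ℵ_ (ω + 1) : Cardinal.{0}).ord.ToType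
  have hΛcof : Order.cof Λ = ℵ_ (ω + 1) := by rw [Ordinal.cof_toType, hreg.cof_ord]
  have : NoMaxOrder Λ := Cardinal.noMaxOrder hreg.aleph0_le
  have hord : (ℵ_ (ω + 1) : Cardinal.{0}).ord.cof.ord = (ℵ_ (ω + 1) : Cardinal.{0}).ord := by
    rw [hreg.cof_ord]
  have hIio (ξ : Λ) : #(Set.Iio ξ) ≤ ℵ_ ω := by
    exact Order.lt_succ_iff.1
      ((mk_Iio_lt_cof hord ξ).trans_eq (hΛcof.trans (Cardinal.succ_aleph ω).symm))
  have hlt (k : ℕ) : ℵ_ (k : Ordinal) < Order.cof Λ := by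
    rw [hΛcof]
    exact Cardinal.aleph_lt_aleph.2 ((Ordinal.natCast_lt_omega0 k).trans (Order.lt_succ ω))
  have h1 : ℵ_ 1 < Order.cof Λ := by simpa using hlt 1
  have h3 : ℵ_ 3 < Order.cof Λ := by simpa using hlt 3
  have hreg3 : (ℵ_ 3 : Cardinal.{0}).IsRegular := by
    have := Cardinal.isRegular_aleph_add_one 2
    rwa [two_add_one_eq_three] at this
  have hE (ξ : Λ) : ∃ E : Set (Set.Iio ξ), #E ≤ ℵ_ ((4 : ℕ) : Ordinal) ∧
      (Order.cof (Set.Iio ξ) = ℵ_ 3 → IsClub E) := by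
    by_cases h : Order.cof (Set.Iio ξ) = ℵ_ 3
    · have : NoMaxOrder (Set.Iio ξ) := by
        have : Nonempty (Set.Iio ξ) := Order.cof_ne_zero_iff.1 (by rw [h]; exact hreg3.ne_zero)
        rw [← noTopOrder_iff_noMaxOrder, ← Order.one_lt_cof_iff, h]
        exact Cardinal.one_lt_aleph0.trans_le hreg3.aleph0_le
      obtain ⟨E, hE, hE'⟩ := exists_isClub_mk_le_cof (Set.Iio ξ)
      refine ⟨E, hE'.trans ?_, fun _ ↦ hE⟩
      rw [h]
      exact Cardinal.aleph_le_aleph.2 (by norm_num)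
    · exact ⟨∅, by simp, fun h' ↦ (h h').elim⟩
  choose E hEcard hEclub using hE
  obtain ⟨f, hfτ, hfinc, hfE⟩ := exists_increasing_sequence_bounding hIio E hEcard
  let D := Filter.hyperfilter ℕ
  have hinc (η ξ : Λ) (h : η < ξ) : ∀ᶠ n in D, f η n < f ξ n :=
    Filter.hyperfilter_le_cofinite (hfinc η ξ h)
  have hproj := exists_forall_eventually_le_leastAbove h3 E hEclub D f hinc hfE
  obtain ⟨g, hg, hg'⟩ := exists_eventually_lub h1 D f hinc omegaAddFive
    (fun ξ n ↦ (hfτ ξ n).le) hproj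
  have hglt (ξ : Λ) : ∀ᶠ n in D, f ξ n < g n := by
    obtain ⟨ζ, hζ⟩ := exists_gt ξ
    filter_upwards [hinc _ _ hζ, hg ζ] with n h₁ h₂ using h₁.trans_le h₂
  refine ⟨D, g, f, ?_, hinc, hglt, fun u hu ↦ ?_⟩
  · filter_upwards [eventually_aleph0_lt_cof D f omegaAddFive (fun ξ n ↦ (hfτ ξ n).le) hproj g hglt
      hg', hg' omegaAddFive fun ξ ↦ .of_forall fun n ↦ (hfτ ξ n).le] with n h₁ h₂
    obtain ⟨o, ho⟩ := Cardinal.mem_range_aleph_iff.2 h₁.le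
    have hle : (g n).cof ≤ ℵ_ (((n + 4 : ℕ) : Ordinal) + 1) := by
      refine (Ordinal.cof_le_card _).trans ((Ordinal.card_le_card h₂).trans_eq ?_)
      rw [omegaAddFive, Ordinal.card_omega]
    rw [← ho] at h₁ hle
    have ho' : o < ω := by
      refine (Cardinal.aleph_le_aleph.1 hle).trans_lt ?_
      exact_mod_cast Ordinal.natCast_lt_omega0 (n + 4 + 1)
    obtain ⟨k, rfl⟩ := Ordinal.lt_omega0.1 ho'
    refine ⟨k, Nat.one_le_iff_ne_zero.2 ?_, ho.symm⟩
    rintro rfl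
    simp at h₁
  -- Modulo an ultrafilter, a `u` that no `f ξ` exceeds is an upper bound of all of them.
  · by_contra! h
    obtain ⟨n, h₁, h₂⟩ := (hu.and (hg' u fun ξ ↦ by simpa using h ξ)).exists
    exact h₂.not_gt h₁

/-! ### Subgroups inducing the full symmetric group on a moiety -/

theorem exists_equiv_eqOn_of_injOn {Ω Ω' : Type*} [Countable Ω] [Countable Ω'] {F : Ω → Ω'}
    {s : Set Ω} (hF : Set.InjOn F s) (hs : sᶜ.Infinite) (hFs : (F '' s)ᶜ.Infinite) :
    ∃ σ : Ω ≃ Ω', Set.EqOn σ F s := by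
  classical
  have := hs.to_subtype
  have := hFs.to_subtype
  obtain ⟨e⟩ := nonempty_equiv_of_countable (α := ↥sᶜ) (β := ↥(F '' s)ᶜ)
  refine ⟨(Equiv.Set.sumCompl s).symm.trans
    (((hF.bijOn_image).equiv F).sumCongr e |>.trans (Equiv.Set.sumCompl _)), fun x hx ↦ ?_⟩
  simp [Equiv.Set.sumCompl_symm_apply_of_mem hx, Set.BijOn.equiv]

theorem exists_equiv_mem_iff {Ω Ω' : Type*} [Countable Ω] [Countable Ω']
    {s : Set Ω} {t : Set Ω'} (hs : s.Infinite) (hs' : sᶜ.Infinite) (ht : t.Infinite)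
    (ht' : tᶜ.Infinite) : ∃ σ : Ω ≃ Ω', ∀ x, σ x ∈ t ↔ x ∈ s := by
  classical
  have := hs.to_subtype
  have := ht.to_subtype
  have := hs'.to_subtype
  have := ht'.to_subtype
  obtain ⟨e⟩ := nonempty_equiv_of_countable (α := s) (β := t)
  obtain ⟨e'⟩ := nonempty_equiv_of_countable (α := ↥sᶜ) (β := ↥tᶜ)
  refine ⟨(Equiv.Set.sumCompl s).symm.trans ((e.sumCongr e').trans (Equiv.Set.sumCompl _)),
    fun x ↦ ?_⟩
  by_cases hx : x ∈ s
  · simp [Equiv.Set.sumCompl_symm_apply_of_mem hx, hx]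
  · have h : (e' ⟨x, hx⟩ : Ω') ∉ t := (e' ⟨x, hx⟩).2
    simpa [Equiv.Set.sumCompl_symm_apply_of_notMem hx, hx] using h

/-- The pointwise stabilizers of three infinite sets partitioning a countable set generate the
symmetric group. -/
theorem Subgroup.eq_top_of_stabilizers_le {Ω : Type*} [Countable Ω] (c : Ω → Fin 3)
    (hc : ∀ k, (c ⁻¹' {k}).Infinite) (M : Subgroup (Equiv.Perm Ω))
    (hM : ∀ k, ∀ π : Equiv.Perm Ω, (∀ x, c x = k → π x = x) → π ∈ M) : M = ⊤ := by
  classical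
  rw [Subgroup.eq_top_iff']
  intro π
  obtain ⟨j, hj⟩ : ∃ j, {x | c x = 0 ∧ c (π x) = j}.Infinite := by
    by_contra! h
    refine hc 0 ((Set.finite_iUnion h).subset fun x hx ↦ ?_)
    exact Set.mem_iUnion.2 ⟨c (π x), hx, rfl⟩
  -- `σ` will fix colour `k` and agree with `π` on `W`. Colours `l` and `l'` leave infinite room
  -- outside its prescribed domain and range.
  obtain ⟨k, l, l', hk0, hkj, hlk, hl0, hlk', hlj'⟩ : ∃ k l l' : Fin 3,
      k ≠ 0 ∧ k ≠ j ∧ l ≠ k ∧ l ≠ 0 ∧ l' ≠ k ∧ l' ≠ j := by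
    clear hj
    revert j
    decide
  set W := {x | c x = 0 ∧ c (π x) = j} with hW
  obtain ⟨σ, hσ⟩ := exists_equiv_eqOn_of_injOn (F := fun x ↦ if c x = k then x else π x)
    (s := {x | c x = k} ∪ W) (by
      rintro x hx y hy hxy
      have := π.injective.eq_iff (a := x) (b := y)
      simp only [hW, Set.mem_union, Set.mem_ofPred_eq] at hx hy
      dsimp only at hxy
      split_ifs at hxy <;> grind)
    ((hc l).mono fun x hx ↦ by
      simp only [hW, Set.mem_compl_iff, Set.mem_union, Set.mem_ofPred_eq]
      have : c x = l := hx
      grind)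
    ((hc l').mono fun x hx ↦ by
      have : c x = l' := hx
      rintro ⟨y, hy, rfl⟩
      simp only [hW, Set.mem_union, Set.mem_ofPred_eq] at hy
      dsimp only at this
      split_ifs at this <;> grind)
  have hσM : σ ∈ M := hM k σ fun x hx ↦ by
    have := hσ (Or.inl hx)
    simpa [hx] using this
  have hρ (x) (hx : x ∈ W) : (σ⁻¹ * π) x = x := by
    have h₁ := hσ (Or.inr hx)
    have h₂ : c x ≠ k := by rw [hx.1]; exact hk0.symm
    simp only [h₂, if_false] at h₁
    rw [Equiv.Perm.mul_apply, Equiv.Perm.inv_eq_iff_eq, h₁]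
  have := (hc 0).to_subtype
  have := hj.to_subtype
  obtain ⟨e⟩ := nonempty_equiv_of_countable (α := ↥(c ⁻¹' {0})) (β := W)
  -- `m` fixes colour 2 and carries colour class 0 onto `W`, so it conjugates `σ⁻¹ * π`, which fixes
  -- `W` pointwise, into the stabilizer of class 0.
  obtain ⟨m, hm⟩ := exists_equiv_eqOn_of_injOn
    (F := fun x ↦ if h : c x = 0 then (e ⟨x, h⟩ : Ω) else x)
    (s := {x | c x = 0} ∪ {x | c x = 2}) (by
      rintro x hx y hy hxy
      simp only [Set.mem_union, Set.mem_ofPred_eq] at hx hy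
      dsimp only at hxy
      split_ifs at hxy with h₁ h₂ h₂
      · exact congrArg Subtype.val (e.injective (Subtype.ext hxy))
      · have := (e ⟨x, h₁⟩).2.1
        grind
      · have := (e ⟨y, h₂⟩).2.1
        grind
      · exact hxy)
    ((hc 1).mono fun x hx ↦ by
      have : c x = 1 := hx
      simp [this])
    ((hc 1).mono fun x hx ↦ by
      have : c x = 1 := hx
      rintro ⟨y, hy, rfl⟩
      simp only [Set.mem_union, Set.mem_ofPred_eq] at hy
      dsimp only at this
      split_ifs at this with h
      · have := (e ⟨y, h⟩).2.1
        grind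
      · grind)
  have hmM : m ∈ M := hM 2 m fun x hx ↦ by
    have := hm (Or.inr hx)
    simpa [hx] using this
  have hconj : m⁻¹ * (σ⁻¹ * π) * m ∈ M := hM 0 _ fun x hx ↦ by
    have h := hm (Or.inl hx)
    simp only [hx, dif_pos] at h
    rw [Equiv.Perm.mul_apply, Equiv.Perm.mul_apply, Equiv.Perm.inv_eq_iff_eq, h]
    exact hρ _ (e ⟨x, hx⟩).2
  have : π = σ * (m * (m⁻¹ * (σ⁻¹ * π) * m) * m⁻¹) := by group
  rw [this]
  exact M.mul_mem hσM (M.mul_mem (M.mul_mem hmM hconj) (M.inv_mem hmM))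

/-- Since `π` preserves `Δ`, so does `h`, and therefore `h` also preserves the complement, where its
values are otherwise unknown. -/
theorem Equiv.Perm.notMem_of_eqOn {Ω : Type*} {Δ : Set Ω} {h π : Equiv.Perm Ω}
    (hπ : ∀ x ∉ Δ, π x = x) (hh : Set.EqOn h π Δ) {x : Ω} (hx : x ∉ Δ) : h x ∉ Δ := by
  intro hx'
  have h₁ : π.symm (h x) ∈ Δ := by
    by_contra h₂
    have := hπ _ h₂
    rw [Equiv.apply_symm_apply] at this
    exact h₂ (this ▸ hx')
  have h₂ := hh h₁
  rw [Equiv.apply_symm_apply] at h₂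
  exact hx (h.injective h₂ ▸ h₁)

/-- The permutation of `(ℤ ⊕ Bool) × ℕ` acting on labels only. -/
def labelPerm (τ : Equiv.Perm (ℤ ⊕ Bool)) : Equiv.Perm ((ℤ ⊕ Bool) × ℕ) :=
  τ.prodCongr (Equiv.refl ℕ)

/-- A permutation of `ℕ` acting on the copies with label in a given set. -/
def blockPerm (p : ℤ ⊕ Bool → Prop) [DecidablePred p] (a : Equiv.Perm ℕ) :
    Equiv.Perm ((ℤ ⊕ Bool) × ℕ) :=
  Equiv.prodCongrRight fun l ↦ if p l then a else 1

/-- If a subgroup of the symmetric group on `(ℤ ⊕ Bool) × ℕ` induces the full symmetric group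
outside the copy labelled `inr false`, then together with a transposition of labels it contains
the symmetric group on the copy labelled `inl 0`. -/
theorem blockPerm_mem (M : Subgroup (Equiv.Perm ((ℤ ⊕ Bool) × ℕ)))
    (hM : ∀ π : Equiv.Perm ((ℤ ⊕ Bool) × ℕ), (∀ x ∉ {x | x.1 ≠ Sum.inr false}, π x = x) →
      ∃ h ∈ M, Set.EqOn h π {x | x.1 ≠ Sum.inr false})
    (hy : labelPerm (Equiv.swap (Sum.inr true) (Sum.inr false)) ∈ M) (a : Equiv.Perm ℕ) :
    blockPerm (· = Sum.inl 0) a ∈ M := by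
  let p : ℤ ⊕ Bool → Prop := Sum.elim (fun j ↦ 0 ≤ j) fun _ ↦ False
  have : DecidablePred p := Classical.decPred p
  set y := labelPerm (Equiv.swap (Sum.inr true) (Sum.inr false)) with hy_def
  have hA : ∀ x ∉ {x : (ℤ ⊕ Bool) × ℕ | x.1 ≠ Sum.inr false}, blockPerm p a x = x := by
    rintro ⟨l, x⟩ hx
    obtain rfl : l = Sum.inr false := by simpa using hx
    simp [blockPerm, p]
  let s := labelPerm (Equiv.sumCongr (Equiv.addRight (1 : ℤ)) (Equiv.refl Bool))
  have hs : ∀ x ∉ {x : (ℤ ⊕ Bool) × ℕ | x.1 ≠ Sum.inr false}, s x = x := by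
    rintro ⟨l, x⟩ hx
    obtain rfl : l = Sum.inr false := by simpa using hx
    simp [labelPerm, s]
  obtain ⟨g, hgM, hg⟩ := hM _ hA
  obtain ⟨h, hhM, hh⟩ := hM _ hs
  have hgl (x : ℕ) : ∃ z, g (Sum.inr false, x) = (Sum.inr false, z) := by
    have := Equiv.Perm.notMem_of_eqOn hA hg (x := (Sum.inr false, x)) (by simp)
    exact ⟨(g (Sum.inr false, x)).2, Prod.ext (by simpa using this) rfl⟩
  have hhl (x : ℕ) : ∃ z, h (Sum.inr false, x) = (Sum.inr false, z) := by
    have := Equiv.Perm.notMem_of_eqOn hs hh (x := (Sum.inr false, x)) (by simp)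
    exact ⟨(h (Sum.inr false, x)).2, Prod.ext (by simpa using this) rfl⟩
  have hgj (j : ℤ) (x : ℕ) : g (Sum.inl j, x) = (Sum.inl j, if 0 ≤ j then a x else x) := by
    rw [hg (by simp)]
    by_cases hj : 0 ≤ j <;> simp [blockPerm, p, hj]
  have hgt (x : ℕ) : g (Sum.inr true, x) = (Sum.inr true, x) := by
    rw [hg (by simp)]
    simp [blockPerm, p]
  have hhj (j : ℤ) (x : ℕ) : h (Sum.inl j, x) = (Sum.inl (j + 1), x) := by
    rw [hh (by simp)]
    simp [labelPerm, s]
  have hht (x : ℕ) : h (Sum.inr true, x) = (Sum.inr true, x) := by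
    rw [hh (by simp)]
    simp [labelPerm, s]
  have hyj (j : ℤ) (x : ℕ) : y (Sum.inl j, x) = (Sum.inl j, x) := by
    simp [y, labelPerm, Equiv.swap_apply_def]
  have hyt (x : ℕ) : y (Sum.inr true, x) = (Sum.inr false, x) := by
    simp [y, labelPerm]
  have hyf (x : ℕ) : y (Sum.inr false, x) = (Sum.inr true, x) := by
    simp [y, labelPerm]
  -- `g` applies `a` on the labels `j ≥ 0` and `h` shifts labels by one, so the commutator of `g`
  -- and `y * h * y` telescopes to `a` on label 0. The unknown action of `g` lives on `inr false`;
  -- conjugation by `y` moves that of `h` to `inr true`. Disjoint supports make both cancel.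
  have hcomm : blockPerm (· = Sum.inl 0) a * (y * h * y) * g = g * (y * h * y) := by
    ext1 ⟨l, x⟩
    simp only [Equiv.Perm.mul_apply]
    obtain j | (_ | _) := l
    · simp only [hgj, hyj, hhj, blockPerm]
      by_cases hj : 0 ≤ j
      · have h₁ : 0 ≤ j + 1 := by omega
        have h₂ : j + 1 ≠ 0 := by omega
        simp [hj, h₁, h₂]
      · by_cases hj' : j + 1 = 0
        · simp [hj, hj']
        · have h₁ : ¬ 0 ≤ j + 1 := by omega
          simp [hj, h₁, hj']
    · obtain ⟨z, hz⟩ := hgl x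
      simp [hz, hyf, hyt, hht, blockPerm]
    · obtain ⟨z, hz⟩ := hhl x
      simp [hz, hyf, hyt, hgt, blockPerm]
  rw [show blockPerm (· = Sum.inl 0) a = g * (y * h * y) * (g⁻¹ * (y * h * y)⁻¹) by
    rw [← hcomm]; group]
  have hM' : y * h * y ∈ M := M.mul_mem (M.mul_mem hy hhM) hy
  exact M.mul_mem (M.mul_mem hgM hM') (M.mul_mem (M.inv_mem hgM) (M.inv_mem hM'))

/-- Macpherson and Neumann: a subgroup of the symmetric group on a countable set that induces the
full symmetric group on an infinite coinfinite set is everything, up to finitely many elements. -/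
theorem exists_finite_forall_eq_top {Ω : Type*} [Countable Ω] {Δ : Set Ω} (hΔ : Δ.Infinite)
    (hΔ' : Δᶜ.Infinite) :
    ∃ T : Set (Equiv.Perm Ω), T.Finite ∧ ∀ M : Subgroup (Equiv.Perm Ω), T ⊆ M →
      (∀ π : Equiv.Perm Ω, (∀ x ∉ Δ, π x = x) → ∃ h ∈ M, Set.EqOn h π Δ) → M = ⊤ := by
  have hfib (l : ℤ ⊕ Bool) : {x : (ℤ ⊕ Bool) × ℕ | x.1 = l}.Infinite :=
    Set.infinite_of_injective_forall_mem (f := fun n : ℕ ↦ ((l, n) : (ℤ ⊕ Bool) × ℕ))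
      (fun m n h ↦ congrArg Prod.snd h) fun n ↦ rfl
  obtain ⟨φ, hφ⟩ := exists_equiv_mem_iff hΔ hΔ' (t := {x : (ℤ ⊕ Bool) × ℕ | x.1 ≠ Sum.inr false})
    ((hfib (Sum.inr true)).mono fun x hx ↦ by
      have : x.1 = Sum.inr true := hx
      simp [this])
    ((hfib (Sum.inr false)).mono fun x hx ↦ by
      have : x.1 = Sum.inr false := hx
      simp [this])
  let c (x : (ℤ ⊕ Bool) × ℕ) : Fin 3 := Fin.ofNat 3 x.2
  have hc (k : Fin 3) : (c ⁻¹' {k}).Infinite :=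
    Set.infinite_of_injective_forall_mem
      (f := fun n : ℕ ↦ ((Sum.inr true, 3 * n + k) : (ℤ ⊕ Bool) × ℕ))
      (fun m n h ↦ by simpa using congrArg Prod.snd h) fun n ↦ by
        simp only [Set.mem_preimage, Set.mem_singleton_iff, c]
        ext
        simp [Nat.mod_eq_of_lt k.2]
  -- `d k` carries copy `inl 0` onto the complement of colour class `k`, so it conjugates the
  -- symmetric group on that copy to the pointwise stabilizer of the class.
  have hd (k : Fin 3) : ∃ d : Equiv.Perm ((ℤ ⊕ Bool) × ℕ),
      ∀ x, d x ∈ {x | c x ≠ k} ↔ x ∈ {x | x.1 = Sum.inl 0} := by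
    refine exists_equiv_mem_iff (hfib _) ((hfib (Sum.inl 1)).mono fun x hx ↦ ?_)
      ((hc (k + 1)).mono fun x hx ↦ ?_) ((hc k).mono fun x hx ↦ ?_)
    · have : x.1 = Sum.inl 1 := hx
      simp [this]
    · have : c x = k + 1 := hx
      simp [this]
    · have : c x = k := hx
      simp [this]
  choose d hd using hd
  let Φ := Equiv.permCongrHom φ
  refine ⟨Φ.symm '' insert (labelPerm (Equiv.swap (Sum.inr true) (Sum.inr false))) (Set.range d),
    ((Set.finite_range d).insert _).image _, fun M hT hM ↦ ?_⟩
  have hmem (π : Equiv.Perm ((ℤ ⊕ Bool) × ℕ)) : π ∈ M.map Φ.toMonoidHom ↔ Φ.symm π ∈ M :=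
    Subgroup.mem_map_equiv
  have hblock := blockPerm_mem (M.map Φ.toMonoidHom) (fun π hπ ↦ by
    obtain ⟨h, hhM, hh⟩ := hM (Φ.symm π) fun x hx ↦ by
      have := hπ (φ x) (fun h ↦ hx ((hφ x).1 h))
      simp [Φ, this]
    refine ⟨Φ h, ⟨h, hhM, rfl⟩, fun x hx ↦ ?_⟩
    have := hh (x := φ.symm x) ((hφ _).1 (by simpa using hx))
    simp [Φ, this]) ((hmem _).2 (hT ⟨_, Set.mem_insert _ _, rfl⟩))
  have hfix (π : Equiv.Perm ((ℤ ⊕ Bool) × ℕ)) (hπ : ∀ x, x.1 ≠ Sum.inl 0 → π x = x) :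
      π ∈ M.map Φ.toMonoidHom := by
    have key (π : Equiv.Perm ((ℤ ⊕ Bool) × ℕ)) (hπ : ∀ x, x.1 ≠ Sum.inl 0 → π x = x) (n : ℕ) :
        π (Sum.inl 0, n) = (Sum.inl 0, (π (Sum.inl 0, n)).2) := by
      refine Prod.ext ?_ rfl
      by_contra h
      have := π.injective (hπ _ h)
      exact h (by rw [this])
    have hπ' (x : (ℤ ⊕ Bool) × ℕ) (hx : x.1 ≠ Sum.inl 0) : π.symm x = x := by
      rw [Equiv.symm_apply_eq, hπ x hx]
    let a : Equiv.Perm ℕ :=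
      ⟨fun n ↦ (π (Sum.inl 0, n)).2, fun n ↦ (π.symm (Sum.inl 0, n)).2,
        fun n ↦ by simp [← key π hπ n], fun n ↦ by simp [← key π.symm hπ' n]⟩
    convert hblock a
    ext1 ⟨l, n⟩
    by_cases hl : l = Sum.inl 0
    · subst hl
      rw [key π hπ]
      simp [blockPerm, a]
    · rw [hπ _ hl]
      simp [blockPerm, hl]
  have htop := Subgroup.eq_top_of_stabilizers_le c hc (M.map Φ.toMonoidHom) fun k π hπ ↦ by
    have hdk : d k ∈ M.map Φ.toMonoidHom :=
      (hmem _).2 (hT ⟨_, Set.mem_insert_of_mem _ ⟨k, rfl⟩, rfl⟩)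
    have := hfix ((d k)⁻¹ * π * d k) fun x hx ↦ by
      have h : c (d k x) = k := by
        by_contra h
        exact hx ((hd k x).1 h)
      rw [Equiv.Perm.mul_apply, Equiv.Perm.mul_apply, Equiv.Perm.inv_eq_iff_eq, hπ _ h]
    have h : π = d k * ((d k)⁻¹ * π * d k) * (d k)⁻¹ := by group
    rw [h]
    exact mul_mem (mul_mem hdk this) (inv_mem hdk)
  rw [Subgroup.eq_top_iff'] at htop ⊢
  intro π
  simpa using (hmem _).1 (htop (Φ π))

/-! ### Chains of proper subgroups and diagonalization -/

/-- A chain of proper subgroups of `G` indexed by the ordinals below `o`, with union `G`. -/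
structure IsProperChain {G : Type*} [Group G] (o : Ordinal.{0}) (K : Ordinal.{0} → Subgroup G) :
    Prop where
  mono : ∀ x y, x ≤ y → y < o → K x ≤ K y
  ne_top : ∀ x < o, K x ≠ ⊤
  exists_mem : ∀ g, ∃ x < o, g ∈ K x

/-- A cofinal subset of `o` of order type `o.cof.ord` transfers the chain: a point below `o`
receives the subgroup indexed by the first member of that subset at or above it. -/
theorem exists_isProperChain {G : Type} [Group G] {o : Ordinal.{0}}
    (h : o.cof ∈ cofinalitySpectrum G) : ∃ K, IsProperChain (G := G) o K := by
  obtain ⟨-, H, hmono, htop, hex⟩ := h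
  obtain ⟨s, hs, hs'⟩ := Ordinal.exists_ord_cof_eq o.ToType
  rw [Ordinal.cof_toType] at hs'
  have hty : typeLT s = typeLT o.cof.ord.ToType := by rw [hs', Ordinal.type_toType]
  obtain ⟨e'⟩ := Ordinal.type_eq.1 hty
  let e : s ≃o o.cof.ord.ToType := OrderIso.ofRelIsoLT e'
  have hr (x : o.ToType) : {i | x ≤ (e.symm i : o.ToType)}.Nonempty := by
    obtain ⟨a, ha, hxa⟩ := hs x
    exact ⟨e ⟨a, ha⟩, by simpa using hxa⟩
  choose r hr using fun x ↦ exists_isLeast_of_nonempty (hr x)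
  have hrmono : Monotone r := fun x y hxy ↦ (hr x).2 (hxy.trans (hr y).1)
  let K (x : Ordinal.{0}) : Subgroup G :=
    if h : x < o then H (Ordinal.ToType.mk.symm (r (Ordinal.ToType.mk ⟨x, h⟩))) else ⊤
  refine ⟨K, ⟨fun x y hxy hy ↦ ?_, fun x hx ↦ ?_, fun g ↦ ?_⟩⟩
  · simp only [K, hxy.trans_lt hy, hy, dif_pos]
    refine hmono ((OrderIso.le_iff_le _).2 (hrmono ((OrderIso.le_iff_le _).2 hxy)))
  · simp only [K, hx, dif_pos]
    exact htop _
  · obtain ⟨i, hi⟩ := hex g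
    let a : o.ToType := e.symm (Ordinal.ToType.mk i)
    have ha : ((Ordinal.ToType.mk.symm a : Set.Iio o) : Ordinal) < o :=
      (Ordinal.ToType.mk.symm a).2
    refine ⟨(Ordinal.ToType.mk.symm a : Set.Iio o), ha, ?_⟩
    simp only [K, ha, dif_pos]
    refine hmono ?_ hi
    rw [OrderIso.le_symm_apply]
    have : Ordinal.ToType.mk ⟨(Ordinal.ToType.mk.symm a : Set.Iio o), ha⟩ = a :=
      Ordinal.ToType.mk.apply_symm_apply a
    rw [this]
    exact e.symm.le_iff_le.1 (hr a).1

theorem IsProperChain.exists_subset {G : Type*} [Group G] {o : Ordinal.{0}}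
    {K : Ordinal.{0} → Subgroup G} (hK : IsProperChain o K) {T : Set G} (hT : T.Finite)
    {x : Ordinal.{0}} (hx : x < o) : ∃ z < o, x ≤ z ∧ T ⊆ K z := by
  induction T, hT using Set.Finite.induction_on with
  | empty => exact ⟨x, hx, le_rfl, Set.empty_subset _⟩
  | @insert g T _ _ ih =>
    obtain ⟨z, hz, hxz, hTz⟩ := ih
    obtain ⟨y, hy, hgy⟩ := hK.exists_mem g
    have hm : max z y < o := max_lt hz hy
    exact ⟨max z y, hm, hxz.trans (le_max_left _ _), Set.insert_subset
      (hK.mono _ _ (le_max_right _ _) hm hgy) (hTz.trans (hK.mono _ _ (le_max_left _ _) hm))⟩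

/-- No member of a chain of proper subgroups induces the full symmetric group on a moiety. -/
theorem IsProperChain.exists_forall_not_eqOn {Ω : Type*} [Countable Ω] {o : Ordinal.{0}}
    {K : Ordinal.{0} → Subgroup (Equiv.Perm Ω)} (hK : IsProperChain o K) {Δ : Set Ω}
    (hΔ : Δ.Infinite) (hΔ' : Δᶜ.Infinite) {x : Ordinal.{0}} (hx : x < o) :
    ∃ π : Equiv.Perm Ω, (∀ a ∉ Δ, π a = a) ∧ ∀ h ∈ K x, ¬ Set.EqOn h π Δ := by
  by_contra! H
  obtain ⟨T, hT, hT'⟩ := exists_finite_forall_eq_top hΔ hΔ'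
  obtain ⟨z, hz, hxz, hTz⟩ := hK.exists_subset hT hx
  refine hK.ne_top z hz (hT' (K z) hTz fun π hπ ↦ ?_)
  obtain ⟨h, hh, hh'⟩ := H π hπ
  exact ⟨h, hK.mono _ _ hxz hz hh, hh'⟩

/-- Each `π n` preserves its own column of the pairing function, and the columns partition ℕ, so the
restrictions glue together. -/
theorem exists_perm_eqOn_column (π : ℕ → Equiv.Perm ℕ)
    (hπ : ∀ n, ∀ a ∉ {m : ℕ | (Nat.unpair m).1 = n}, π n a = a) :
    ∃ σ : Equiv.Perm ℕ, ∀ n, Set.EqOn σ (π n) {m : ℕ | (Nat.unpair m).1 = n} := by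
  have key (n a : ℕ) (ha : (Nat.unpair a).1 = n) : (Nat.unpair (π n a)).1 = n := by
    by_contra h
    have := (π n).injective (hπ n _ h)
    rw [this] at h
    exact h ha
  have key' (n a : ℕ) (ha : (Nat.unpair a).1 = n) : (Nat.unpair ((π n).symm a)).1 = n := by
    by_contra h
    have := hπ n _ h
    rw [Equiv.apply_symm_apply] at this
    exact h (this ▸ ha)
  refine ⟨⟨fun m ↦ π (Nat.unpair m).1 m, fun m ↦ (π (Nat.unpair m).1).symm m, fun m ↦ ?_,
    fun m ↦ ?_⟩, fun n m hm ↦ ?_⟩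
  · simp only [key _ m rfl, Equiv.symm_apply_apply]
  · simp only [key' _ m rfl, Equiv.apply_symm_apply]
  · have : (Nat.unpair m).1 = n := hm
    simp [this]

/-- Countably many proper chains for the symmetric group on `ℕ` can be avoided simultaneously. -/
theorem exists_perm_forall_notMem {o x : ℕ → Ordinal.{0}}
    {K : ℕ → Ordinal.{0} → Subgroup (Equiv.Perm ℕ)} :
    ∃ σ : Equiv.Perm ℕ, ∀ n, IsProperChain (o n) (K n) → x n < o n → σ ∉ K n (x n) := by
  have hinf (n : ℕ) : {m : ℕ | (Nat.unpair m).1 = n}.Infinite :=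
    Set.infinite_of_injective_forall_mem (f := fun k ↦ Nat.pair n k)
      (fun k l h ↦ (Nat.pair_eq_pair.1 h).2) fun k ↦ by simp
  have hinf' (n : ℕ) : {m : ℕ | (Nat.unpair m).1 = n}ᶜ.Infinite :=
    (hinf (n + 1)).mono fun m hm ↦ by
      have : (Nat.unpair m).1 = n + 1 := hm
      simp [this]
  have hex (n : ℕ) : ∃ π : Equiv.Perm ℕ, (∀ a ∉ {m : ℕ | (Nat.unpair m).1 = n}, π a = a) ∧
      (IsProperChain (o n) (K n) → x n < o n →
        ∀ h ∈ K n (x n), ¬ Set.EqOn h π {m : ℕ | (Nat.unpair m).1 = n}) := by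
    by_cases h : IsProperChain (o n) (K n) ∧ x n < o n
    · obtain ⟨π, hπ, hπ'⟩ := h.1.exists_forall_not_eqOn (hinf n) (hinf' n) h.2
      exact ⟨π, hπ, fun _ _ ↦ hπ'⟩
    · exact ⟨1, fun _ _ ↦ rfl, fun h₁ h₂ ↦ (h ⟨h₁, h₂⟩).elim⟩
  choose π hπ hπ' using hex
  obtain ⟨σ, hσ⟩ := exists_perm_eqOn_column π hπ
  exact ⟨σ, fun n h₁ h₂ hmem ↦ hπ' n h₁ h₂ σ hmem (hσ n)⟩

/-! ### The chain of length ω_{ω+1} -/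

/-- The subgroup of elements that lie in `K n` for almost all `n`. -/
def eventuallySubgroup {G : Type*} [Group G] (D : Filter ℕ) (K : ℕ → Subgroup G) : Subgroup G where
  carrier := {g | ∀ᶠ n in D, g ∈ K n}
  mul_mem' ha hb := by
    filter_upwards [ha, hb] with n h₁ h₂ using mul_mem h₁ h₂
  one_mem' := .of_forall fun n ↦ one_mem _
  inv_mem' ha := by
    filter_upwards [ha] with n h₁ using inv_mem h₁

theorem mem_eventuallySubgroup {G : Type*} [Group G] {D : Filter ℕ} {K : ℕ → Subgroup G} {g : G} :
    g ∈ eventuallySubgroup D K ↔ ∀ᶠ n in D, g ∈ K n := Iff.rfl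

theorem theorem1p2
    (h : ∀ n : ℕ, 1 ≤ n → ℵ_ (n : Ordinal.{0}) ∈ cofinalitySpectrum (Equiv.Perm ℕ)) :
    ℵ_ (ω + 1) ∈ cofinalitySpectrum (Equiv.Perm ℕ) := by
  obtain ⟨D, g, f, hg, hinc, hlt, hexact⟩ := exists_scale_aleph_omega_add_one
  have hK (n : ℕ) : ∃ K : Ordinal.{0} → Subgroup (Equiv.Perm ℕ),
      (∃ k : ℕ, 1 ≤ k ∧ (g n).cof = ℵ_ (k : Ordinal)) → IsProperChain (g n) K := by
    by_cases hn : ∃ k : ℕ, 1 ≤ k ∧ (g n).cof = ℵ_ (k : Ordinal)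
    · obtain ⟨k, hk, hk'⟩ := hn
      obtain ⟨K, hK⟩ := exists_isProperChain (hk' ▸ h k hk)
      exact ⟨K, fun _ ↦ hK⟩
    · exact ⟨fun _ ↦ ⊤, fun h' ↦ (hn h').elim⟩
  choose K hK using hK
  have hchain : ∀ᶠ n in D, IsProperChain (g n) (K n) := hg.mono hK
  refine ⟨Cardinal.isRegular_aleph_add_one ω,
    fun i ↦ eventuallySubgroup D fun n ↦ K n (f (Ordinal.ToType.mk i) n),
    fun i j hij ↦ ?_, fun i htop ↦ ?_, fun π ↦ ?_⟩
  · obtain rfl | hij := hij.eq_or_lt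
    · exact le_rfl
    intro π hπ
    rw [mem_eventuallySubgroup] at hπ ⊢
    filter_upwards [hπ, hchain, hinc _ _ ((OrderIso.lt_iff_lt Ordinal.ToType.mk).2 hij), hlt _]
      with n h₁ h₂ h₃ h₄ using h₂.mono _ _ h₃.le h₄ h₁
  · obtain ⟨σ, hσ⟩ := exists_perm_forall_notMem (o := g) (x := f (Ordinal.ToType.mk i)) (K := K)
    have hmem : σ ∈ eventuallySubgroup D fun n ↦ K n (f (Ordinal.ToType.mk i) n) :=
      (Subgroup.eq_top_iff' _).1 htop σ
    obtain ⟨n, h₁, h₂, h₃⟩ := ((mem_eventuallySubgroup.1 hmem).and (hchain.and (hlt _))).exists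
    exact hσ n h₂ h₃ h₁
  · have hu (n : ℕ) : ∃ x, IsProperChain (g n) (K n) → x < g n ∧ π ∈ K n x := by
      by_cases hn : IsProperChain (g n) (K n)
      · obtain ⟨x, hx⟩ := hn.exists_mem π
        exact ⟨x, fun _ ↦ hx⟩
      · exact ⟨0, fun h' ↦ (hn h').elim⟩
    choose u hu using hu
    -- `u n` is a stage at which `π` enters the `n`-th chain; cofinality of `f` puts all of these
    -- below a single `f ξ` modulo `D`.
    obtain ⟨ξ, hξ⟩ := hexact u (hchain.mono fun n hn ↦ (hu n hn).1)
    refine ⟨Ordinal.ToType.mk.symm ξ, ?_⟩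
    rw [mem_eventuallySubgroup, OrderIso.apply_symm_apply]
    filter_upwards [hξ, hlt ξ, hchain] with n h₁ h₂ h₃
    exact h₃.mono _ _ h₁.le h₂ (hu n h₃).2
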